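/- Let $N\ge 1$, let $I\subseteq\mathbb R$ be an open interval, and let $u_n(t)>0$ ($n\in\mathbb Z$, $t\in I$) be a differentiable solution of the Volterra chain $u_n'=u_n(u_{n+1}-u_{n-1})$ with $u_{n+N}=u_n$. Put $a_n=\tfrac12\sqrt{u_n}$. For $k\in\mathbb Z$ let $\theta_{n,k}(\lambda,t)$ and $\varphi_{n,k}(\lambda,t)$ be the solutions of the discrete Hill (Jacobi) equation with zero diagonal $$a_{n+k-1}y_{n-1}+a_{n+k}y_{n+1}=\lambda y_n$$ with $\theta_{0,k}=1,\ \theta_{1,k}=0$ and $\varphi_{0,k}=0,\ \varphi_{1,k}=1$, and write $\theta_n=\theta_{n,0}$, $\varphi_n=\varphi_{n,0}$, $\Delta=\theta_N+\varphi_{N+1}$. Let $\lambda_1\le\dots\le\lambda_{2N}$ be the zeros, with multiplicity, of $\Delta(\lambda,t)^2-4$ (the periodic and antiperiodic band edges), and let $\mu_{1,k}(t)<\dots<\mu_{N-1,k}(t)$ be the zeros of $\theta_{N+1,k}(\cdot,t)$; write $\mu_j=\mu_{j,0}$. Put $\sigma_{j,k}=\operatorname{sign}\bigl(\theta_{N,k}(\mu_{j,k})-1/\theta_{N,k}(\mu_{j,k})\bigr)$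 and $\sigma_j=\sigma_{j,0}$. Then, for all $t\in I$ and $k\in\mathbb Z$: (a) These objects are well defined: $\Delta^2-4=\bigl(\prod_{n=1}^N a_n\bigr)^{-2}\prod_{i=1}^{2N}(\lambda-\lambda_i)$ with real $\lambda_i$, the $\lambda_i$ do not depend on $t$, $\theta_{N+1,k}$ has exactly $N-1$ distinct real zeros, $\theta_{N,k}(\mu_{j,k})\ne0$, and $\prod_{i=1}^{2N}(\mu_{j,k}-\lambda_i)\ge 0$. (b) The $\mu_j$ are differentiable and $$\mu_j'=-4\mu_j\sigma_j\frac{\sqrt{\prod_{i=1}^{2N}(\mu_j-\lambda_i)}}{\prod_{i\ne j}(\mu_j-\mu_i)},\qquad j=1,\dots,N-1.$$ (c) More generally, the shifted parameters $\mu_{j,k}$ are differentiable and $$\mu_{j,k}'=-4\mu_{j,k}\sigma_{j,k}\frac{\sqrt{\prod_{i=1}^{2N}(\mu_{j,k}-\lambda_i)}}{\prod_{i\ne j}(\mu_{j,k}-\mu_{i,k})},\qquad j=1,\dots,N-1.$$ (d) If $N\ge4$ and no $\mu_j(t)$ equals any $\lambda_i$, then, at time $t$, the numbers $D_j=\sigma_j\sqrt{\prod_{i=1}^{2N}(\mu_j-\lambda_i)}$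 are nonzero and $$\sum_{j=1}^{N-1}\frac{\mu_j^{s-1}\mu_j'}{D_j}=0\quad(1\le s\le N-3),\qquad \sum_{j=1}^{N-1}\frac{\mu_j^{N-3}\mu_j'}{D_j}=-4,\qquad \sum_{j=1}^{N-1}\frac{\mu_j^{N-2}\mu_j'}{D_j}=0.$$ -/

import Mathlib

open Polynomial

noncomputable section

/-- Positive solutions of the Volterra chain `u_n' = u_n (u_{n+1} - u_{n-1})` of period `N`,
on a time set `I`. -/
structure IsPeriodicVolterraSolution (N : ℕ) (I : Set ℝ) (u : ℤ → ℝ → ℝ) : Prop where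
  pos : ∀ n, ∀ t ∈ I, 0 < u n t
  periodic : ∀ n, ∀ t ∈ I, u (n + N) t = u n t
  deriv_eq : ∀ n, ∀ t ∈ I, HasDerivAt (u n) (u n t * (u (n + 1) t - u (n - 1) t)) t

/-- The coefficients `a_n(t) = (1/2) √(u_n(t))`. -/
def volterraCoeff (u : ℤ → ℝ → ℝ) (t : ℝ) (n : ℤ) : ℝ := 1 / 2 * Real.sqrt (u n t)

/-- The solution of the discrete Hill equation
`a_{n-1} y_{n-1} + b_n y_n + a_n y_{n+1} = x y_n` with `y_0 = c₀`, `y_1 = c₁`,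
for `n ≥ 0`, as a polynomial in the spectral variable `x`. -/
def hillSol (a b : ℤ → ℝ) (c₀ c₁ : ℝ) : ℕ → ℝ[X]
  | 0 => C c₀
  | 1 => C c₁
  | n + 2 => C (a (n + 1))⁻¹ *
      ((X - C (b (n + 1))) * hillSol a b c₀ c₁ (n + 1) - C (a n) * hillSol a b c₀ c₁ n)

/-- `θ_n`: the solution with `θ_0 = 1`, `θ_1 = 0`. -/
def hillTheta (a b : ℤ → ℝ) (n : ℕ) : ℝ[X] := hillSol a b 1 0 n

/-- `φ_n`: the solution with `φ_0 = 0`, `φ_1 = 1`. -/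
def hillPhi (a b : ℤ → ℝ) (n : ℕ) : ℝ[X] := hillSol a b 0 1 n

/-- The Hill discriminant `Δ = θ_N + φ_{N+1}`. -/
def hillDiscriminant (a b : ℤ → ℝ) (N : ℕ) : ℝ[X] := hillTheta a b N + hillPhi a b (N + 1)

/-- The `i`-th (counting from `0`) real root of `p`, in nondecreasing order and with multiplicity;
`0` if there are at most `i` of them. -/
def sortedRoot (p : ℝ[X]) (i : ℕ) : ℝ := (p.roots.sort (· ≤ ·)).getD i 0

/-- The periodic and antiperiodic band edges `λ_1 ≤ … ≤ λ_{2N}` of the Hill equation attached to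
`u` at time `t` (with `b = 0`): the roots of `Δ² - 4`. -/
def bandEdge (N : ℕ) (u : ℤ → ℝ → ℝ) (i : Fin (2 * N)) (t : ℝ) : ℝ :=
  sortedRoot (hillDiscriminant (volterraCoeff u t) 0 N ^ 2 - 4) i

/-- `θ_{n,k}` at time `t`: the solution `θ_n` for the coefficients shifted by `k`,
`n ↦ a_{n+k}(t)`, and `b = 0`. -/
def volterraTheta (u : ℤ → ℝ → ℝ) (k : ℤ) (t : ℝ) (n : ℕ) : ℝ[X] :=
  hillTheta (fun m => volterraCoeff u t (m + k)) 0 n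

/-- The auxiliary spectral parameters `μ_{1,k}(t) < … < μ_{N-1,k}(t)`: the roots of `θ_{N+1,k}`.
The unshifted parameters `μ_j` are those with `k = 0`. -/
def auxParam (N : ℕ) (u : ℤ → ℝ → ℝ) (k : ℤ) (j : Fin (N - 1)) (t : ℝ) : ℝ :=
  sortedRoot (volterraTheta u k t (N + 1)) j

/-- `σ_{j,k}(t) = sign (θ_{N,k}(μ_{j,k}) - 1 / θ_{N,k}(μ_{j,k}))`. -/
def auxSign (N : ℕ) (u : ℤ → ℝ → ℝ) (k : ℤ) (j : Fin (N - 1)) (t : ℝ) : ℝ :=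
  Real.sign ((volterraTheta u k t N).eval (auxParam N u k j t)
    - 1 / (volterraTheta u k t N).eval (auxParam N u k j t))

/-- `√(∏_{i=1}^{2N} (μ_{j,k} - λ_i))` at time `t`. -/
def auxRoot (N : ℕ) (u : ℤ → ℝ → ℝ) (k : ℤ) (j : Fin (N - 1)) (t : ℝ) : ℝ :=
  Real.sqrt (∏ i : Fin (2 * N), (auxParam N u k j t - bandEdge N u i t))

end

/-!
Write `M = !![θ_N, φ_N; θ_{N+1}, φ_{N+1}]` for the monodromy matrix, a polynomial matrix of
determinant `1` with trace `Δ`, and `A = a_1 ⋯ a_N`.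

At a fixed time everything follows from Green's identity. A complex zero of `Δ² - 4` carries a
solution with `y_{n+N} = ± y_n`, and a complex zero of `θ_{N+1}` makes `θ` a Dirichlet eigenfunction;
in both cases the boundary terms agree, so the zero is real (`hill_spectral_real`). The
Christoffel–Darboux identity makes the zeros of `θ_{N+1}` simple. The trace of `M` is unchanged when
the period starts at another site (`hillDiscriminant_shift_int`), so all shifts share the band edges.

In time, a solution of the Hill equation with constant initial data satisfies a zero-curvature
equation (`hasDerivAt_hillSol_eval`), so that `M' = [B, M]` with
`B = 2 !![a_{-1}² - a_0² - x², 2 x a_0; -2 x a_0, x² + a_0² - a_1²]`. Hence `Δ` and the band edges are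
constant, and at a zero `μ` of `θ_{N+1}` the commutator reduces to
`θ_{N+1}' = -4 μ a_0 (θ_N - φ_{N+1})`. The implicit function theorem moves the simple zeros
(`hasDerivAt_sortedRoot`), where `∂θ_{N+1}/∂x = -(a_0 / A) ∏_{i ≠ j} (μ_j - μ_i)`. Since `det M = 1`,
at `μ` one has `φ_{N+1} = 1 / θ_N` and `Δ² - 4 = (θ_N - 1 / θ_N)²`, so that
`σ √(∏ (μ - λ_i)) = A (θ_N - 1 / θ_N)` with its sign (`auxSign_mul_auxRoot`), which gives the
equations of motion.

Dividing these by `D_j` leaves `-4 ∑ μ_j ^ s / ∏_{i ≠ j} (μ_j - μ_i)`, which Lagrange interpolation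
evaluates as `0` for `s < N - 2`, as `-4` for `s = N - 2`, and as `-4 ∑ μ_j` for `s = N - 1`; the last
sum vanishes because `θ_{N+1}` is even or odd.
-/

/-! ### Solutions of the zero-diagonal Hill equation -/

theorem hillSol_add_two {a : ℤ → ℝ} (ha : ∀ n, 0 < a n) (c d : ℝ) (n : ℕ) :
    C (a (n + 1)) * hillSol a 0 c d (n + 2)
      = X * hillSol a 0 c d (n + 1) - C (a n) * hillSol a 0 c d n := by
  have h : C (a (n + 1)) * C (a (n + 1))⁻¹ = (1 : ℝ[X]) := by
    rw [← C_mul, mul_inv_cancel₀ (ha _).ne', C_1]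
  simp only [hillSol, Pi.zero_apply, C_0, sub_zero]
  rw [← mul_assoc, h, one_mul]

theorem hillSol_eq_theta_add_phi (a : ℤ → ℝ) (c d : ℝ) :
    ∀ n : ℕ, hillSol a 0 c d n = C c * hillTheta a 0 n + C d * hillPhi a 0 n
  | 0 => by simp [hillSol, hillTheta, hillPhi]
  | 1 => by simp [hillSol, hillTheta, hillPhi]
  | n + 2 => by
    have h₁ := hillSol_eq_theta_add_phi a c d n
    have h₂ := hillSol_eq_theta_add_phi a c d (n + 1)
    simp only [hillTheta, hillPhi] at h₁ h₂ ⊢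
    rw [hillSol, h₁, h₂, hillSol, hillSol]
    ring

/-- A solution moved one site to the left solves the equation with shifted coefficients, hence is
a combination of the shifted fundamental solutions. -/
theorem hillSol_succ_eq_shift (a : ℤ → ℝ) (c d : ℝ) :
    ∀ n : ℕ, hillSol a 0 c d (n + 1) = C d * hillTheta (fun m => a (m + 1)) 0 n
      + hillSol a 0 c d 2 * hillPhi (fun m => a (m + 1)) 0 n
  | 0 => by simp [hillSol, hillTheta, hillPhi]
  | 1 => by simp [hillSol, hillTheta, hillPhi]
  | n + 2 => by
    have h₁ := hillSol_succ_eq_shift a c d n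
    have h₂ := hillSol_succ_eq_shift a c d (n + 1)
    simp only [hillTheta, hillPhi] at h₁ h₂ ⊢
    rw [hillSol.eq_3 a 0 c d (n + 1), h₁, h₂, hillSol.eq_3 (fun m => a (m + 1)),
      hillSol.eq_3 (fun m => a (m + 1))]
    simp only [Nat.cast_add, Nat.cast_one, Pi.zero_apply]
    ring

theorem hillSol_wronskian {a : ℤ → ℝ} (ha : ∀ n, 0 < a n) (n : ℕ) :
    C (a n) * (hillTheta a 0 n * hillPhi a 0 (n + 1) - hillTheta a 0 (n + 1) * hillPhi a 0 n)
      = C (a 0) := by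
  induction n with
  | zero => simp [hillTheta, hillPhi, hillSol]
  | succ n ih =>
    have h₁ := hillSol_add_two ha 1 0 n
    have h₂ := hillSol_add_two ha 0 1 n
    simp only [hillTheta, hillPhi] at ih ⊢
    push_cast
    linear_combination hillSol a 0 1 0 (n + 1) * h₂ - hillSol a 0 0 1 (n + 1) * h₁ + ih

/-- The determinant of the monodromy matrix is `1`. -/
theorem hill_det_monodromy {a : ℤ → ℝ} {N : ℕ} (ha : ∀ n, 0 < a n) (hp : ∀ n, a (n + N) = a n) :
    hillTheta a 0 N * hillPhi a 0 (N + 1) - hillTheta a 0 (N + 1) * hillPhi a 0 N = 1 := by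
  have h := hillSol_wronskian ha N
  have h0 : a N = a 0 := by simpa using hp 0
  rw [h0] at h
  exact mul_left_cancel₀ (C_ne_zero.mpr (ha 0).ne') (h.trans (mul_one _).symm)

theorem hillDiscriminant_shift {a : ℤ → ℝ} {N : ℕ} (ha : ∀ n, 0 < a n)
    (hp : ∀ n, a (n + N) = a n) :
    hillDiscriminant (fun m => a (m + 1)) 0 N = hillDiscriminant a 0 N := by
  have hN : a N = a 0 := by simpa using hp 0
  have hN1 : a (N + 1) = a 1 := by rw [add_comm]; exact hp 1
  have h0 := (ha 0).ne'
  have h1 := (ha 1).ne'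
  have hθ2 : C (a 1) * hillSol a 0 1 0 2 = - C (a 0) := by
    simpa [hillSol] using hillSol_add_two ha 1 0 0
  have hφ2 : C (a 1) * hillSol a 0 0 1 2 = X := by
    simpa [hillSol] using hillSol_add_two ha 0 1 0
  have e1 := hillSol_succ_eq_shift a 1 0 N
  have e2 := hillSol_succ_eq_shift a 1 0 (N + 1)
  have e3 := hillSol_succ_eq_shift a 0 1 N
  have e4 := hillSol_add_two ha 1 0 N
  rw [hN, hN1] at e4
  simp only [C_0, C_1, zero_mul, zero_add, one_mul] at e1 e2 e3
  apply mul_left_cancel₀ (C_ne_zero.mpr h0)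
  apply mul_left_cancel₀ (C_ne_zero.mpr h1)
  simp only [hillDiscriminant, hillTheta, hillPhi] at *
  generalize hillSol (fun m => a (m + 1)) 0 1 0 N = t at *
  generalize hillSol (fun m => a (m + 1)) 0 0 1 N = p at *
  generalize hillSol (fun m => a (m + 1)) 0 0 1 (N + 1) = p' at *
  rw [e1, e2] at e4
  rw [e3]
  have e5 : C (a 0) * hillSol a 0 1 0 N = X * (hillSol a 0 1 0 2 * p) + C (a 0) * p' := by
    linear_combination e4 - p' * hθ2
  linear_combination -C (a 1) * e5 - X * p * hθ2 - C (a 0) * p * hφ2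

theorem hillDiscriminant_shift_int {a : ℤ → ℝ} {N : ℕ} (ha : ∀ n, 0 < a n)
    (hp : ∀ n, a (n + N) = a n) (k : ℤ) :
    hillDiscriminant (fun m => a (m + k)) 0 N = hillDiscriminant a 0 N := by
  have key (k : ℤ) : hillDiscriminant (fun m => a (m + (k + 1))) 0 N
      = hillDiscriminant (fun m => a (m + k)) 0 N := by
    rw [← hillDiscriminant_shift (a := fun m => a (m + k)) (fun _ => ha _)
      (fun n => by rw [add_right_comm]; exact hp _)]
    simp only [add_assoc, add_comm (1 : ℤ)]
  induction k using Int.induction_on with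
  | zero => simp
  | succ i ih => rw [key, ih]
  | pred i ih => rw [← ih, ← key, sub_add_cancel]

/-! ### Degrees and leading coefficients -/

theorem hillSol_degree_coeff {a : ℤ → ℝ} (c d : ℝ) (n : ℕ) :
    (hillSol a 0 c d n).natDegree ≤ n ∧ (hillSol a 0 c d (n + 1)).natDegree ≤ n ∧
      (hillSol a 0 c d (n + 1)).coeff n = d * ∏ i ∈ Finset.range n, (a (i + 1))⁻¹ := by
  induction n with
  | zero => simp [hillSol]
  | succ n ih =>
    obtain ⟨h₁, h₂, h₃⟩ := ih
    refine ⟨h₂.trans n.le_succ, ?_, ?_⟩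
    · simp only [hillSol, Pi.zero_apply, C_0, sub_zero]
      refine (natDegree_C_mul_le _ _).trans ((natDegree_sub_le _ _).trans (max_le ?_ ?_))
      · refine natDegree_mul_le.trans ?_
        rw [natDegree_X]; omega
      · exact (natDegree_C_mul_le _ _).trans (h₁.trans n.le_succ)
    · simp only [hillSol, Pi.zero_apply, C_0, sub_zero, coeff_C_mul, coeff_sub, coeff_X_mul, h₃,
        coeff_eq_zero_of_natDegree_lt (Nat.lt_succ_of_le h₁), Finset.prod_range_succ]
      ring

theorem hillTheta_degree_coeff {a : ℤ → ℝ} {N : ℕ} (hN : 1 ≤ N) :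
    (hillTheta a 0 (N + 1)).natDegree ≤ N - 1 ∧ (hillTheta a 0 (N + 1)).coeff (N - 1)
      = -(a 0 * (∏ i ∈ Finset.range N, a (i + 1))⁻¹) := by
  obtain ⟨m, rfl⟩ : ∃ m, N = m + 1 := ⟨N - 1, by omega⟩
  have h := hillSol_succ_eq_shift a 1 0 (m + 1)
  have h2 : hillSol a 0 1 0 2 = C (-((a 1)⁻¹ * a 0)) := by
    simp [hillSol]
  obtain ⟨-, hd, hc⟩ := hillSol_degree_coeff (a := fun n => a (n + 1)) 0 1 m
  rw [hillTheta, h, h2]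
  simp only [hillPhi, C_0, zero_mul, zero_add, Nat.add_sub_cancel]
  refine ⟨(natDegree_C_mul_le _ _).trans hd, ?_⟩
  rw [coeff_C_mul, hc, Finset.prod_range_succ', Finset.prod_inv_distrib]
  simp only [Nat.cast_add, Nat.cast_one, Nat.cast_zero, zero_add, mul_inv]
  ring

theorem hillDiscriminant_degree_coeff {a : ℤ → ℝ} {N : ℕ} (hN : 1 ≤ N) :
    (hillDiscriminant a 0 N).natDegree ≤ N ∧ (hillDiscriminant a 0 N).coeff N
      = (∏ i ∈ Finset.range N, a (i + 1))⁻¹ := by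
  obtain ⟨m, rfl⟩ : ∃ m, N = m + 1 := ⟨N - 1, by omega⟩
  obtain ⟨-, h₁, -⟩ := hillSol_degree_coeff (a := a) 1 0 m
  obtain ⟨-, h₂, h₃⟩ := hillSol_degree_coeff (a := a) 0 1 (m + 1)
  refine ⟨(natDegree_add_le _ _).trans (max_le (h₁.trans m.le_succ) h₂), ?_⟩
  rw [hillDiscriminant, coeff_add, hillTheta, hillPhi, h₃,
    coeff_eq_zero_of_natDegree_lt (Nat.lt_succ_of_le h₁), Finset.prod_inv_distrib]
  ring

/-- With zero diagonal, the polynomials `θ_n` are alternately even and odd. -/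
theorem hillTheta_eval_neg (a : ℤ → ℝ) (x : ℝ) (n : ℕ) :
    (hillTheta a 0 n).eval (-x) = (-1) ^ n * (hillTheta a 0 n).eval x ∧
    (hillTheta a 0 (n + 1)).eval (-x) = (-1) ^ (n + 1) * (hillTheta a 0 (n + 1)).eval x := by
  induction n with
  | zero => simp [hillTheta, hillSol]
  | succ n ih =>
    refine ⟨ih.2, ?_⟩
    obtain ⟨h₁, h₂⟩ := ih
    simp only [hillTheta] at h₁ h₂ ⊢
    simp only [hillSol, Pi.zero_apply, C_0, sub_zero, eval_mul, eval_sub, eval_C, eval_X, h₁, h₂]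
    ring

/-! ### Reality of the spectra -/

/-- Green's identity for a complex solution at a complex spectral parameter. -/
theorem hill_green {a : ℤ → ℝ} {z : ℂ} {y : ℕ → ℂ}
    (hy : ∀ n : ℕ, a (n + 1) * y (n + 2) = z * y (n + 1) - a n * y n) (N : ℕ) :
    (a N : ℂ) * (y (N + 1) * star (y N) - y N * star (y (N + 1)))
      = a 0 * (y 1 * star (y 0) - y 0 * star (y 1))
        + (z - star z) * ∑ n ∈ Finset.range N, y (n + 1) * star (y (n + 1)) := by
  induction N with
  | zero => simp
  | succ n ih =>
    have h := hy n
    have h' := congrArg star h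
    simp only [star_mul', star_sub, Complex.star_def, Complex.conj_ofReal] at h' ih ⊢
    rw [Finset.sum_range_succ]
    push_cast
    linear_combination (starRingEnd ℂ) (y (n + 1)) * h - y (n + 1) * h' + ih

/-- If the boundary terms in Green's identity agree, the spectral parameter is real. -/
theorem hill_spectral_real {a : ℤ → ℝ} {z : ℂ} {y : ℕ → ℂ}
    (hy : ∀ n : ℕ, a (n + 1) * y (n + 2) = z * y (n + 1) - a n * y n) {N : ℕ}
    (hb : (a N : ℂ) * (y (N + 1) * star (y N) - y N * star (y (N + 1)))
      = a 0 * (y 1 * star (y 0) - y 0 * star (y 1)))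
    (hne : ∃ n < N, y (n + 1) ≠ 0) : z.im = 0 := by
  have h := hill_green hy N
  rw [hb, left_eq_add, mul_eq_zero] at h
  rcases h with h | h
  · exact Complex.conj_eq_iff_im.mp (sub_eq_zero.mp h).symm
  · exfalso
    obtain ⟨n, hn, hyn⟩ := hne
    have h' : ((∑ n ∈ Finset.range N, Complex.normSq (y (n + 1)) : ℝ) : ℂ) = 0 := by
      rw [← h]
      push_cast
      exact Finset.sum_congr rfl fun n _ => (Complex.mul_conj _).symm
    have := (Finset.sum_eq_zero_iff_of_nonneg fun n _ => Complex.normSq_nonneg _).mp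
      (Complex.ofReal_eq_zero.mp h') n (Finset.mem_range.mpr hn)
    exact hyn (Complex.normSq_eq_zero.mp this)

theorem aeval_hillSol_add_two {a : ℤ → ℝ} (ha : ∀ n, 0 < a n) (c d : ℝ) (z : ℂ) (n : ℕ) :
    a (n + 1) * aeval z (hillSol a 0 c d (n + 2))
      = z * aeval z (hillSol a 0 c d (n + 1)) - a n * aeval z (hillSol a 0 c d n) := by
  simpa using congrArg (aeval z) (hillSol_add_two ha c d n)

theorem splits_of_aeval_complex_im_eq_zero {p : ℝ[X]}
    (h : ∀ z : ℂ, aeval z p = 0 → z.im = 0) : p.Splits := by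
  refine Splits.of_splits_map (algebraMap ℝ ℂ) (IsAlgClosed.splits _) fun z hz => ?_
  have hz' : aeval z p = 0 := by
    rw [aeval_def, ← eval_map]
    exact (mem_roots'.mp hz).2
  exact ⟨z.re, Complex.ext rfl (by simpa using (h z hz').symm)⟩

/-- A zero of `θ_{N+1}` is a Dirichlet eigenvalue: the boundary terms of `θ` in Green's identity
vanish. -/
theorem hillTheta_splits {a : ℤ → ℝ} {N : ℕ} (hN : 1 ≤ N) (ha : ∀ n, 0 < a n)
    (hp : ∀ n, a (n + N) = a n) : (hillTheta a 0 (N + 1)).Splits := by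
  refine splits_of_aeval_complex_im_eq_zero fun z hz => ?_
  refine hill_spectral_real (y := fun n => aeval z (hillTheta a 0 n)) (N := N)
    (aeval_hillSol_add_two ha 1 0 z) ?_ ⟨N - 1, by omega, ?_⟩
  · simp only [hz]
    simp [hillTheta, hillSol]
  · intro h0
    rw [Nat.sub_add_cancel hN] at h0
    have := congrArg (aeval z) (hill_det_monodromy ha hp)
    simp [hz, h0] at this

/-- A zero of `Δ² - 4` carries a (complex) solution with `y_{n+N} = ± y_n`, so it is real. -/
theorem hillDiscriminant_sq_sub_four_splits {a : ℤ → ℝ} {N : ℕ} (hN : 1 ≤ N) (ha : ∀ n, 0 < a n)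
    (hp : ∀ n, a (n + N) = a n) : (hillDiscriminant a 0 N ^ 2 - 4).Splits := by
  refine splits_of_aeval_complex_im_eq_zero fun z hz => ?_
  have hdet := congrArg (aeval z) (hill_det_monodromy ha hp)
  simp only [hillDiscriminant, map_sub, map_pow, map_add, map_mul, map_one, map_ofNat] at hz hdet
  obtain ⟨ε, hε, htr⟩ : ∃ ε : ℂ, (ε = 1 ∨ ε = -1) ∧
      aeval z (hillTheta a 0 N) + aeval z (hillPhi a 0 (N + 1)) = 2 * ε := by
    have : (aeval z (hillTheta a 0 N) + aeval z (hillPhi a 0 (N + 1)) - 2) *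
      (aeval z (hillTheta a 0 N) + aeval z (hillPhi a 0 (N + 1)) + 2) = 0 := by
      linear_combination hz
    rcases mul_eq_zero.mp this with h | h
    · exact ⟨1, Or.inl rfl, by linear_combination h⟩
    · exact ⟨-1, Or.inr rfl, by linear_combination h⟩
  have hε2 : ε * ε = 1 := by rcases hε with rfl | rfl <;> norm_num
  have hεs : star ε = ε := by rcases hε with rfl | rfl <;> simp
  -- an eigenvector of the monodromy matrix at the eigenvalue `ε`
  obtain ⟨v, hv, hMv⟩ := Matrix.exists_mulVec_eq_zero_iff.mpr
    (show (!![aeval z (hillTheta a 0 N) - ε, aeval z (hillPhi a 0 N);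
        aeval z (hillTheta a 0 (N + 1)), aeval z (hillPhi a 0 (N + 1)) - ε]).det = 0 by
      rw [Matrix.det_fin_two_of]
      linear_combination hdet - hε2 - ε * htr)
  have hv0 := congrFun hMv 0
  have hv1 := congrFun hMv 1
  simp only [Matrix.mulVec, dotProduct, Fin.sum_univ_two, Matrix.of_apply, Matrix.cons_val',
    Matrix.cons_val_zero, Matrix.cons_val_one, Matrix.cons_val_fin_one, Pi.zero_apply] at hv0 hv1
  set y : ℕ → ℂ := fun n => v 0 * aeval z (hillTheta a 0 n) + v 1 * aeval z (hillPhi a 0 n) with hy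
  have hy0 : y 0 = v 0 := by simp [hy, hillTheta, hillPhi, hillSol]
  have hy1 : y 1 = v 1 := by simp [hy, hillTheta, hillPhi, hillSol]
  have hyN : y N = ε * y 0 := by rw [hy0]; linear_combination hv0
  have hyN1 : y (N + 1) = ε * y 1 := by rw [hy1]; linear_combination hv1
  have haN : a N = a 0 := by simpa using hp 0
  refine hill_spectral_real (a := a) (y := y) (N := N) (fun n => ?_) ?_ ?_
  · have e1 := aeval_hillSol_add_two ha 1 0 z n
    have e2 := aeval_hillSol_add_two ha 0 1 z n
    simp only [hy, hillTheta, hillPhi]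
    linear_combination v 0 * e1 + v 1 * e2
  · rw [hyN, hyN1, haN, star_mul', star_mul', hεs]
    linear_combination (a 0 : ℂ) * (y 1 * star (y 0) - y 0 * star (y 1)) * hε2
  · by_contra! hall
    refine hv (funext fun i => ?_)
    have h1 : v 1 = 0 := hy1 ▸ hall 0 (by omega)
    have h2 : v 0 = 0 := by
      have := hall (N - 1) (by omega)
      rw [Nat.sub_add_cancel hN, hyN, hy0] at this
      linear_combination ε * this - v 0 * hε2
    fin_cases i
    · exact h2
    · exact h1

/-- The Christoffel–Darboux identity on the diagonal. -/
theorem hill_christoffel_darboux {a : ℤ → ℝ} (ha : ∀ n, 0 < a n) (c d : ℝ) (N : ℕ) :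
    C (a N) * (derivative (hillSol a 0 c d (N + 1)) * hillSol a 0 c d N
        - derivative (hillSol a 0 c d N) * hillSol a 0 c d (N + 1))
      = ∑ n ∈ Finset.range N, hillSol a 0 c d (n + 1) ^ 2 := by
  induction N with
  | zero => simp [hillSol]
  | succ n ih =>
    have h := hillSol_add_two ha c d n
    have h' := congrArg derivative h
    simp only [derivative_mul, derivative_sub, derivative_C, derivative_X, zero_mul, zero_add,
      one_mul] at h'
    rw [Finset.sum_range_succ]
    push_cast
    linear_combination hillSol a 0 c d (n + 1) * h'
      - derivative (hillSol a 0 c d (n + 1)) * h + ih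

theorem hillTheta_eval_ne_zero_of_root {a : ℤ → ℝ} {N : ℕ} (ha : ∀ n, 0 < a n)
    (hp : ∀ n, a (n + N) = a n) {x : ℝ} (hx : (hillTheta a 0 (N + 1)).eval x = 0) :
    (hillTheta a 0 N).eval x ≠ 0 := by
  intro h0
  have := congrArg (eval x) (hill_det_monodromy ha hp)
  simp [hx, h0] at this

/-- At a double zero the Christoffel–Darboux sum of squares would vanish, and with it `θ_N`. -/
theorem hillTheta_derivative_ne_zero_of_root {a : ℤ → ℝ} {N : ℕ} (hN : 1 ≤ N) (ha : ∀ n, 0 < a n)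
    (hp : ∀ n, a (n + N) = a n) {x : ℝ} (hx : (hillTheta a 0 (N + 1)).eval x = 0) :
    (derivative (hillTheta a 0 (N + 1))).eval x ≠ 0 := by
  intro h0
  have h := congrArg (eval x) (hill_christoffel_darboux ha 1 0 N)
  simp only [hillTheta] at h0 hx
  simp only [eval_mul, eval_sub, h0, hx, zero_mul, mul_zero, sub_zero, eval_finsetSum,
    eval_pow] at h
  have := (Finset.sum_eq_zero_iff_of_nonneg fun n _ => sq_nonneg _).mp h.symm (N - 1)
    (Finset.mem_range.mpr (by omega))
  rw [Nat.sub_add_cancel hN] at this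
  exact hillTheta_eval_ne_zero_of_root ha hp hx (pow_eq_zero_iff two_ne_zero |>.mp this)

/-! ### Sorted roots -/

theorem prod_X_sub_C_sortedRoot {p : ℝ[X]} {n : ℕ} (hp : p.Splits) (hn : p.natDegree = n) :
    p = C p.leadingCoeff * ∏ i : Fin n, (X - C (sortedRoot p i)) := by
  have hl : (p.roots.sort (· ≤ ·)).length = n := by
    rw [Multiset.length_sort, ← hn, hp.natDegree_eq_card_roots]
  have h : ∏ i : Fin n, (X - C (sortedRoot p i)) = (p.roots.map (X - C ·)).prod := by
    conv_rhs => rw [← Multiset.sort_eq p.roots (· ≤ ·)]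
    rw [Multiset.map_coe, Multiset.prod_coe]
    simp only [sortedRoot]
    generalize p.roots.sort (· ≤ ·) = l at hl
    subst hl
    rw [← Fin.prod_univ_fun_getElem l (fun x => X - C x)]
    simp
  rw [h]
  exact hp.eq_prod_roots

theorem sortedRoot_strictMono {p : ℝ[X]} {n : ℕ} (hn : p.roots.card = n) (hp : p.roots.Nodup) :
    StrictMono fun i : Fin n => sortedRoot p i := by
  have hs : (p.roots.sort (· ≤ ·)).SortedLT :=
    (Multiset.pairwise_sort p.roots (· ≤ ·)).sortedLE.sortedLT_of_nodup
      (by rwa [← Multiset.coe_nodup, Multiset.sort_eq])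
  intro i j hij
  have hl := Multiset.length_sort (s := p.roots) (r := (· ≤ ·))
  simp only [sortedRoot]
  rw [List.getD_eq_getElem _ _ (by omega), List.getD_eq_getElem _ _ (by omega)]
  exact hs.strictMono_get (a := ⟨i, by omega⟩) (b := ⟨j, by omega⟩) hij

/-- If a polynomial of degree at most `m` has `m` zeros in increasing order, these are its sorted
roots. -/
theorem sortedRoot_eq_of_strictMono {p : ℝ[X]} {m : ℕ} (hp : p ≠ 0) (hm : p.natDegree ≤ m)
    {g : Fin m → ℝ} (hg : StrictMono g) (hr : ∀ j, p.eval (g j) = 0) (j : Fin m) :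
    sortedRoot p j = g j := by
  have hnd : (List.ofFn g).Nodup := List.nodup_ofFn.mpr hg.injective
  have hle : (List.ofFn g : Multiset ℝ) ≤ p.roots := by
    rw [Multiset.le_iff_subset (Multiset.coe_nodup.mpr hnd)]
    intro x hx
    obtain ⟨i, rfl⟩ := (List.mem_ofFn' _ _).mp (Multiset.mem_coe.mp hx)
    exact (mem_roots hp).mpr (hr i)
  have heq : (List.ofFn g : Multiset ℝ) = p.roots :=
    Multiset.eq_of_le_of_card_le hle (by simpa using (card_roots' p).trans hm)
  have hsort : p.roots.sort (· ≤ ·) = List.ofFn g := by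
    refine List.Perm.eq_of_sortedLE (Multiset.pairwise_sort p.roots (· ≤ ·)).sortedLE
      (List.sortedLE_ofFn_iff.mpr hg.monotone) ?_
    rw [← Multiset.coe_eq_coe, Multiset.sort_eq, heq]
  rw [sortedRoot, hsort, List.getD_eq_getElem _ _ (by simp)]
  simp

/-- Simple sorted roots of a `C¹` family of polynomials move differentiably, with the velocity
given by implicit differentiation. -/
theorem hasDerivAt_sortedRoot {p : ℝ → ℝ[X]} {t : ℝ} {m : ℕ}
    (hne : ∀ᶠ s in nhds t, p s ≠ 0) (hdeg : ∀ᶠ s in nhds t, (p s).natDegree ≤ m)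
    (hmono : StrictMono fun j : Fin m => sortedRoot (p t) j)
    (hroot : ∀ j : Fin m, (p t).eval (sortedRoot (p t) j) = 0)
    (hsimple : ∀ j : Fin m, (derivative (p t)).eval (sortedRoot (p t) j) ≠ 0)
    (hC : ∀ j : Fin m, ContDiffAt ℝ 1 (fun q : ℝ × ℝ => (p q.1).eval q.2)
      (t, sortedRoot (p t) j)) (j : Fin m) {d : ℝ}
    (hd : HasDerivAt (fun s => (p s).eval (sortedRoot (p t) j)) d t) :
    HasDerivAt (fun s => sortedRoot (p s) j)
      (-d / (derivative (p t)).eval (sortedRoot (p t) j)) t := by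
  set r : Fin m → ℝ := fun j => sortedRoot (p t) j with hr
  have hS (i : Fin m) := (hC i).hasStrictFDerivAt one_ne_zero
  have hx (i : Fin m) : (fderiv ℝ (fun q : ℝ × ℝ => (p q.1).eval q.2) (t, r i)) (0, 1)
      = (derivative (p t)).eval (r i) := by
    have h1 : HasDerivAt (fun x : ℝ => (t, x)) ((0 : ℝ), (1 : ℝ)) (r i) :=
      (hasDerivAt_const _ _).prodMk (hasDerivAt_id _)
    exact ((hS i).hasFDerivAt.comp_hasDerivAt (r i) h1).unique ((p t).hasDerivAt (r i))
  have hinv (i : Fin m) : ((fderiv ℝ (fun q : ℝ × ℝ => (p q.1).eval q.2) (t, r i)) ∘L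
      .inr ℝ ℝ ℝ).IsInvertible := by
    refine ⟨ContinuousLinearEquiv.unitsEquivAut ℝ (Units.mk0 _ (hsimple i)), ?_⟩
    ext
    simpa using (hx i).symm
  -- the implicit functions through the roots at time `t`
  choose g hg using fun i : Fin m =>
    (⟨_, (hS i).hasStrictFDerivAt_implicitFunctionOfProdDomain (hinv i),
      (hS i).tendsto_implicitFunctionOfProdDomain (hinv i),
      (hS i).eventually_apply_implicitFunctionOfProdDomain (hinv i)⟩ :
    ∃ g : ℝ → ℝ, HasStrictFDerivAt g _ _ ∧ Filter.Tendsto g (nhds t) (nhds (r i)) ∧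
      ∀ᶠ s in nhds t, (p s).eval (g s) = (p t).eval (r i))
  have hgd (i : Fin m) : DifferentiableAt ℝ (g i) t := (hg i).1.differentiableAt
  have hgt (i : Fin m) : g i t = r i :=
    tendsto_nhds_unique (hgd i).continuousAt (hg i).2.1
  have hgmono : ∀ᶠ s in nhds t, StrictMono fun i => g i s := by
    have : ∀ᶠ s in nhds t, ∀ i k : Fin m, i < k → g i s < g k s := by
      refine Filter.eventually_all.mpr fun i => Filter.eventually_all.mpr fun k => ?_
      by_cases hik : i < k
      · filter_upwards [(hg i).2.1.eventually_lt (hg k).2.1 (hmono hik)] with s hs _ using hs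
      · exact Filter.Eventually.of_forall fun s h => absurd h hik
    filter_upwards [this] with s hs i k hik using hs i k hik
  have heq : (fun s => sortedRoot (p s) j) =ᶠ[nhds t] g j := by
    filter_upwards [hne, hdeg, hgmono, Filter.eventually_all.mpr fun i => (hg i).2.2]
      with s h1 h2 h3 h4
    exact sortedRoot_eq_of_strictMono h1 h2 h3 (fun i => (h4 i).trans (hroot i)) j
  -- differentiate `p s (g j s) = 0`
  have h1 : HasDerivAt (fun s => (s, g j s)) ((1 : ℝ), deriv (g j) t) t :=
    (hasDerivAt_id t).prodMk (hgd j).hasDerivAt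
  have hSj : HasFDerivAt (fun q : ℝ × ℝ => (p q.1).eval q.2)
      (fderiv ℝ (fun q : ℝ × ℝ => (p q.1).eval q.2) (t, r j)) (t, g j t) := by
    rw [hgt j]; exact (hS j).hasFDerivAt
  have h2 := hSj.comp_hasDerivAt t h1
  have h3 : HasDerivAt (fun s => (p s).eval (g j s)) 0 t :=
    (hasDerivAt_const t ((p t).eval (r j))).congr_of_eventuallyEq (hg j).2.2
  have h4 := h2.unique h3
  have h5 : HasDerivAt (fun s : ℝ => (s, r j)) ((1 : ℝ), (0 : ℝ)) t :=
    (hasDerivAt_id t).prodMk (hasDerivAt_const _ _)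
  have h6 : (fderiv ℝ (fun q : ℝ × ℝ => (p q.1).eval q.2) (t, r j)) (1, 0) = d :=
    ((hS j).hasFDerivAt.comp_hasDerivAt (f := fun s : ℝ => (s, r j)) t h5).unique hd
  have hlin : ((1 : ℝ), deriv (g j) t) = (1, 0) + deriv (g j) t • ((0 : ℝ), (1 : ℝ)) := by simp
  rw [hlin, map_add, map_smul, h6, hx j, smul_eq_mul] at h4
  have hfin : deriv (g j) t = -d / (derivative (p t)).eval (r j) := by
    rw [eq_div_iff (hsimple j)]; linear_combination h4
  rw [← hfin]
  exact (hgd j).hasDerivAt.congr_of_eventuallyEq heq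

/-! ### Band edges and auxiliary spectrum at a fixed time -/

theorem hillDiscriminant_sq_sub_four_eq {a : ℤ → ℝ} {N : ℕ} (hN : 1 ≤ N) (ha : ∀ n, 0 < a n)
    (hp : ∀ n, a (n + N) = a n) :
    hillDiscriminant a 0 N ^ 2 - 4 = C ((∏ n ∈ Finset.range N, a (n + 1))⁻¹ ^ 2)
      * ∏ i : Fin (2 * N), (X - C (sortedRoot (hillDiscriminant a 0 N ^ 2 - 4) i)) := by
  obtain ⟨h₁, h₂⟩ := hillDiscriminant_degree_coeff (a := a) hN
  have h4 : (4 : ℝ[X]) = C 4 := rfl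
  have hc : (hillDiscriminant a 0 N ^ 2 - 4).coeff (2 * N)
      = (∏ n ∈ Finset.range N, a (n + 1))⁻¹ ^ 2 := by
    rw [coeff_sub, coeff_pow_of_natDegree_le h₁, h₂, h4, coeff_C_of_ne_zero (by omega), sub_zero]
  have hle : (hillDiscriminant a 0 N ^ 2 - 4).natDegree ≤ 2 * N := by
    rw [h4, natDegree_sub_C]
    exact natDegree_pow_le_of_le 2 h₁
  have hd : (hillDiscriminant a 0 N ^ 2 - 4).natDegree = 2 * N := by
    refine natDegree_eq_of_le_of_coeff_ne_zero hle ?_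
    rw [hc]
    exact pow_ne_zero _ (inv_ne_zero (Finset.prod_ne_zero_iff.mpr fun i _ => (ha _).ne'))
  have h := prod_X_sub_C_sortedRoot (hillDiscriminant_sq_sub_four_splits hN ha hp) hd
  rwa [leadingCoeff, hd, hc] at h

theorem hillTheta_natDegree {a : ℤ → ℝ} {N : ℕ} (hN : 1 ≤ N) (ha : ∀ n, 0 < a n) :
    (hillTheta a 0 (N + 1)).natDegree = N - 1 := by
  obtain ⟨h₁, h₂⟩ := hillTheta_degree_coeff (a := a) hN
  refine natDegree_eq_of_le_of_coeff_ne_zero h₁ ?_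
  rw [h₂]
  exact neg_ne_zero.mpr (mul_ne_zero (ha 0).ne'
    (inv_ne_zero (Finset.prod_ne_zero_iff.mpr fun i _ => (ha _).ne')))

theorem hillTheta_ne_zero {a : ℤ → ℝ} {N : ℕ} (hN : 1 ≤ N) (ha : ∀ n, 0 < a n) :
    hillTheta a 0 (N + 1) ≠ 0 := by
  intro h
  have h₂ := (hillTheta_degree_coeff (a := a) hN).2
  rw [h, coeff_zero, eq_comm, neg_eq_zero] at h₂
  exact mul_ne_zero (ha 0).ne'
    (inv_ne_zero (Finset.prod_ne_zero_iff.mpr fun i _ => (ha _).ne')) h₂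

theorem hillTheta_eq_prod {a : ℤ → ℝ} {N : ℕ} (hN : 1 ≤ N) (ha : ∀ n, 0 < a n)
    (hp : ∀ n, a (n + N) = a n) :
    hillTheta a 0 (N + 1) = C (-(a 0 * (∏ i ∈ Finset.range N, a (i + 1))⁻¹))
      * ∏ j : Fin (N - 1), (X - C (sortedRoot (hillTheta a 0 (N + 1)) j)) := by
  have hd := hillTheta_natDegree hN ha
  have h := prod_X_sub_C_sortedRoot (hillTheta_splits hN ha hp) hd
  rwa [leadingCoeff, hd, (hillTheta_degree_coeff hN).2] at h

theorem hillTheta_eval_eq_zero_iff {a : ℤ → ℝ} {N : ℕ} (hN : 1 ≤ N) (ha : ∀ n, 0 < a n)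
    (hp : ∀ n, a (n + N) = a n) (x : ℝ) :
    (hillTheta a 0 (N + 1)).eval x = 0
      ↔ ∃ j : Fin (N - 1), x = sortedRoot (hillTheta a 0 (N + 1)) j := by
  have hc : -(a 0 * (∏ i ∈ Finset.range N, a (i + 1))⁻¹) ≠ 0 :=
    neg_ne_zero.mpr (mul_ne_zero (ha 0).ne'
      (inv_ne_zero (Finset.prod_ne_zero_iff.mpr fun i _ => (ha _).ne')))
  conv_lhs => rw [hillTheta_eq_prod hN ha hp]
  rw [eval_mul, eval_C, eval_prod, mul_eq_zero, or_iff_right hc, Finset.prod_eq_zero_iff]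
  simp [sub_eq_zero]

theorem hillTheta_sortedRoot_strictMono {a : ℤ → ℝ} {N : ℕ} (hN : 1 ≤ N) (ha : ∀ n, 0 < a n)
    (hp : ∀ n, a (n + N) = a n) :
    StrictMono fun j : Fin (N - 1) => sortedRoot (hillTheta a 0 (N + 1)) j := by
  have hs := hillTheta_splits hN ha hp
  have h0 := hillTheta_ne_zero hN ha
  refine sortedRoot_strictMono (by rw [← hs.natDegree_eq_card_roots, hillTheta_natDegree hN ha]) ?_
  rw [Multiset.nodup_iff_count_le_one]
  intro x
  rw [count_roots]
  by_contra! hlt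
  obtain ⟨h1, h2⟩ := (one_lt_rootMultiplicity_iff_isRoot h0).mp hlt
  exact hillTheta_derivative_ne_zero_of_root hN ha hp h1 h2

theorem hillTheta_derivative_eval_sortedRoot {a : ℤ → ℝ} {N : ℕ} (hN : 1 ≤ N) (ha : ∀ n, 0 < a n)
    (hp : ∀ n, a (n + N) = a n) (j : Fin (N - 1)) :
    (derivative (hillTheta a 0 (N + 1))).eval (sortedRoot (hillTheta a 0 (N + 1)) j)
      = -(a 0 * (∏ i ∈ Finset.range N, a (i + 1))⁻¹)
        * ∏ i ∈ Finset.univ.erase j, (sortedRoot (hillTheta a 0 (N + 1)) j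
          - sortedRoot (hillTheta a 0 (N + 1)) i) := by
  have h := congrArg derivative (hillTheta_eq_prod hN ha hp)
  rw [derivative_C_mul, derivative_prod_finset] at h
  rw [h, eval_C_mul, eval_finsetSum, Finset.sum_eq_single j]
  · simp [eval_prod]
  · intro i _ hij
    rw [eval_mul, eval_prod, Finset.prod_eq_zero (Finset.mem_erase.mpr ⟨hij.symm, Finset.mem_univ j⟩)
      (by simp), zero_mul]
  · simp

/-- The zeros of `θ_{N+1}` are symmetric about `0`, by parity. -/
theorem sum_sortedRoot_hillTheta {a : ℤ → ℝ} {N : ℕ} (hN : 1 ≤ N) (ha : ∀ n, 0 < a n)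
    (hp : ∀ n, a (n + N) = a n) :
    ∑ j : Fin (N - 1), sortedRoot (hillTheta a 0 (N + 1)) j = 0 := by
  set r : Fin (N - 1) → ℝ := fun j => sortedRoot (hillTheta a 0 (N + 1)) j with hr
  have hinj : r.Injective := (hillTheta_sortedRoot_strictMono hN ha hp).injective
  have hneg : ∀ j, ∃ i, -r j = r i := fun j => by
    rw [← hillTheta_eval_eq_zero_iff hN ha hp, (hillTheta_eval_neg a _ (N + 1)).1,
      (hillTheta_eval_eq_zero_iff hN ha hp _).mpr ⟨j, rfl⟩, mul_zero]
  choose e he using hneg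
  have hbij : e.Bijective := Finite.injective_iff_bijective.mp fun i k hik =>
    hinj (neg_injective ((he i).trans ((congrArg r hik).trans (he k).symm)))
  have h : ∑ j, r j = ∑ j, -r j := by
    rw [← hbij.sum_comp r]
    exact Finset.sum_congr rfl fun j _ => (he j).symm
  rw [Finset.sum_neg_distrib] at h
  linarith

/-- At a zero of `θ_{N+1}` one has `θ_N φ_{N+1} = 1`, so `Δ² - 4` is the square of
`θ_N - 1 / θ_N`. -/
theorem hillDiscriminant_eval_of_root {a : ℤ → ℝ} {N : ℕ} (ha : ∀ n, 0 < a n)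
    (hp : ∀ n, a (n + N) = a n) {x : ℝ} (hx : (hillTheta a 0 (N + 1)).eval x = 0) :
    1 / (hillTheta a 0 N).eval x = (hillPhi a 0 (N + 1)).eval x ∧
    (hillDiscriminant a 0 N ^ 2 - 4).eval x
      = ((hillTheta a 0 N).eval x - 1 / (hillTheta a 0 N).eval x) ^ 2 := by
  have h0 := hillTheta_eval_ne_zero_of_root ha hp hx
  have h := congrArg (eval x) (hill_det_monodromy ha hp)
  simp only [eval_sub, eval_mul, hx, zero_mul, sub_zero, eval_one] at h
  have h1 : 1 / (hillTheta a 0 N).eval x = (hillPhi a 0 (N + 1)).eval x := by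
    rw [div_eq_iff h0]; linear_combination -h
  refine ⟨h1, ?_⟩
  rw [h1]
  simp only [hillDiscriminant, eval_sub, eval_pow, eval_add, eval_ofNat]
  linear_combination 4 * h

/-- The factorization of `Δ² - 4` at a zero of `θ_{N+1}`. -/
theorem prod_sub_bandEdge_of_root {a : ℤ → ℝ} {N : ℕ} (hN : 1 ≤ N) (ha : ∀ n, 0 < a n)
    (hp : ∀ n, a (n + N) = a n) {x : ℝ} (hx : (hillTheta a 0 (N + 1)).eval x = 0) :
    ∏ i : Fin (2 * N), (x - sortedRoot (hillDiscriminant a 0 N ^ 2 - 4) i)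
      = ((∏ n ∈ Finset.range N, a (n + 1))
        * ((hillTheta a 0 N).eval x - 1 / (hillTheta a 0 N).eval x)) ^ 2 := by
  have hA : (∏ n ∈ Finset.range N, a (n + 1)) ≠ 0 :=
    Finset.prod_ne_zero_iff.mpr fun i _ => (ha _).ne'
  have h := congrArg (eval x) (hillDiscriminant_sq_sub_four_eq hN ha hp)
  rw [(hillDiscriminant_eval_of_root ha hp hx).2, eval_mul, eval_C, eval_prod] at h
  simp only [eval_sub, eval_X, eval_C] at h
  rw [mul_pow, h, inv_pow, mul_inv_cancel_left₀ (pow_ne_zero 2 hA)]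

theorem sign_mul_sqrt_sq_mul {A w : ℝ} (hA : 0 ≤ A) :
    Real.sign w * Real.sqrt ((A * w) ^ 2) = A * w := by
  rw [Real.sqrt_sq_eq_abs, abs_mul, abs_of_nonneg hA]
  rcases lt_trichotomy w 0 with h | rfl | h
  · rw [Real.sign_of_neg h, abs_of_neg h]; ring
  · simp
  · rw [Real.sign_of_pos h, abs_of_pos h]; ring

/-! ### Lagrange sums -/

/-- Lagrange interpolation of `x ^ s` at `m` nodes, read off in degree `m - 1`. -/
theorem sum_pow_div_prod_sub {m : ℕ} {r : Fin m → ℝ} (hr : r.Injective) {s : ℕ} (hs : s < m) :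
    ∑ j, r j ^ s / ∏ i ∈ Finset.univ.erase j, (r j - r i) = if s = m - 1 then 1 else 0 := by
  have h := Lagrange.coeff_eq_sum (s := Finset.univ) (v := r) hr.injOn (P := X ^ s)
    (by rw [degree_X_pow, Finset.card_univ, Fintype.card_fin]; exact_mod_cast hs)
  simp only [coeff_X_pow, eval_pow, eval_X, Finset.card_univ, Fintype.card_fin] at h
  rw [← h]
  simp only [eq_comm]

/-- One degree above the range of interpolation the Lagrange sum equals the sum of the nodes. -/
theorem sum_pow_card_div_prod_sub {m : ℕ} (hm : 0 < m) {r : Fin m → ℝ} (hr : r.Injective)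
    (hsum : ∑ j, r j = 0) :
    ∑ j, r j ^ m / ∏ i ∈ Finset.univ.erase j, (r j - r i) = 0 := by
  set Q : ℝ[X] := ∏ i, (X - C (r i)) with hQ
  have hQm : Q.Monic := monic_prod_of_monic _ _ fun i _ => monic_X_sub_C _
  have hQd : Q.natDegree = m := by simp [hQ]
  have hQc : Q.coeff (m - 1) = 0 := by
    have := prod_X_sub_C_coeff_card_pred Finset.univ r (by simpa using hm)
    rw [Finset.card_univ, Fintype.card_fin] at this
    rw [hQ, this, hsum, neg_zero]
  -- the interpolant of `x ^ m` at the nodes is `x ^ m - Q`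
  have hdeg : (X ^ m - Q).degree < ((Finset.univ : Finset (Fin m)).card : WithBot ℕ) := by
    have h := degree_sub_lt_left (p := X ^ m) (q := Q)
      (by rw [degree_X_pow, degree_eq_natDegree hQm.ne_zero, hQd]) (pow_ne_zero _ X_ne_zero)
      (by rw [leadingCoeff_X_pow, hQm.leadingCoeff])
    rwa [Finset.card_univ, Fintype.card_fin, ← degree_X_pow (R := ℝ)]
  have h := Lagrange.coeff_eq_sum (s := Finset.univ) (v := r) hr.injOn hdeg
  rw [Finset.card_univ, Fintype.card_fin, coeff_sub, hQc, coeff_X_pow, if_neg (by omega),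
    sub_zero] at h
  rw [h]
  refine Finset.sum_congr rfl fun j _ => ?_
  have h0 : Q.eval (r j) = 0 := by
    rw [hQ, eval_prod]
    exact Finset.prod_eq_zero (Finset.mem_univ j) (by simp)
  rw [eval_sub, h0, sub_zero, eval_pow, eval_X]

/-! ### Evolution of the monodromy matrix along the Volterra flow -/

/-- The zero-curvature equation. The Lax flow `y_n' = 2 (a_n a_{n+1} y_{n+2} - a_{n-1} a_{n-2} y_{n-2})`
becomes, modulo the Hill equation, `4 x a_n y_{n+1} + 2 (a_{n-1}² - a_n² - x²) y_n`. A solution with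
constant initial data `c, d` follows this flow, corrected by the solution whose initial data are the
velocities the flow would give to `c` and `d`. -/
theorem hasDerivAt_hillSol_eval {a : ℝ → ℤ → ℝ} {t : ℝ} (ha : ∀ n, 0 < a t n)
    (hd : ∀ n, HasDerivAt (fun s => a s n) (2 * a t n * (a t (n + 1) ^ 2 - a t (n - 1) ^ 2)) t)
    (c d x : ℝ) : ∀ n : ℕ, HasDerivAt (fun s => (hillSol (a s) 0 c d n).eval x)
      (4 * x * a t n * (hillSol (a t) 0 c d (n + 1)).eval x
        + 2 * (a t (n - 1) ^ 2 - a t n ^ 2 - x ^ 2) * (hillSol (a t) 0 c d n).eval x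
        - (hillSol (a t) 0 (4 * x * a t 0 * d + 2 * (a t (-1) ^ 2 - a t 0 ^ 2 - x ^ 2) * c)
          (2 * (x ^ 2 + a t 0 ^ 2 - a t 1 ^ 2) * d - 4 * x * a t 0 * c) n).eval x) t
  | 0 => by
    simp only [hillSol, eval_C]
    refine (hasDerivAt_const t c).congr_deriv ?_
    push_cast
    ring_nf
  | 1 => by
    have h := congrArg (eval x) (hillSol_add_two ha c d 0)
    simp only [hillSol.eq_1, hillSol.eq_2, zero_add, eval_C, eval_mul, eval_sub, eval_X] at h ⊢
    refine (hasDerivAt_const t d).congr_deriv ?_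
    push_cast at h ⊢
    linear_combination -4 * x * h
  | n + 2 => by
    have h₀ := hasDerivAt_hillSol_eval ha hd c d x n
    have h₁ := hasDerivAt_hillSol_eval ha hd c d x (n + 1)
    set p := 4 * x * a t 0 * d + 2 * (a t (-1) ^ 2 - a t 0 ^ 2 - x ^ 2) * c
    set q := 2 * (x ^ 2 + a t 0 ^ 2 - a t 1 ^ 2) * d - 4 * x * a t 0 * c
    have r₁ := congrArg (eval x) (hillSol_add_two ha c d n)
    have r₂ := congrArg (eval x) (hillSol_add_two ha c d (n + 1))
    have r₃ := congrArg (eval x) (hillSol_add_two ha p q n)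
    have hstep (s : ℝ) : (hillSol (a s) 0 c d (n + 2)).eval x = (a s (n + 1))⁻¹
        * (x * (hillSol (a s) 0 c d (n + 1)).eval x - a s n * (hillSol (a s) 0 c d n).eval x) := by
      simp [hillSol]
    simp only [hstep]
    have hD := ((hd (n + 1)).fun_inv (ha _).ne').fun_mul
      ((h₁.const_mul x).fun_sub ((hd n).fun_mul h₀))
    refine hD.congr_deriv ?_
    simp only [eval_mul, eval_sub, eval_C, eval_X] at r₁ r₂ r₃
    have e1 : ((n + 1 : ℕ) : ℤ) = n + 1 := by push_cast; rfl
    have e2 : ((n + 2 : ℕ) : ℤ) = n + 1 + 1 := by push_cast; ring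
    have e3 : (n : ℤ) + 1 + 1 - 1 = n + 1 := by ring
    have e4 : (n : ℤ) + 1 - 1 = n := by ring
    rw [← hstep, ← r₁]
    rw [e1] at r₂ ⊢
    rw [e2, e3, e4]
    have h1 := (ha (n + 1)).ne'
    field_simp
    linear_combination r₃ - 4 * x * a t (n + 1) * r₂
      + 2 * (a t n ^ 2 - a t (n + 1) ^ 2 + x ^ 2) * r₁

/-- The trace of the monodromy matrix is conserved: its derivative is the trace of a
commutator. -/
theorem hasDerivAt_hillDiscriminant_eval {a : ℝ → ℤ → ℝ} {t : ℝ} {N : ℕ} (ha : ∀ n, 0 < a t n)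
    (hp : ∀ n, a t (n + N) = a t n)
    (hd : ∀ n, HasDerivAt (fun s => a s n) (2 * a t n * (a t (n + 1) ^ 2 - a t (n - 1) ^ 2)) t)
    (x : ℝ) : HasDerivAt (fun s => (hillDiscriminant (a s) 0 N).eval x) 0 t := by
  simp only [hillDiscriminant, hillTheta, hillPhi, eval_add]
  refine ((hasDerivAt_hillSol_eval ha hd 1 0 x N).fun_add
    (hasDerivAt_hillSol_eval ha hd 0 1 x (N + 1))).congr_deriv ?_
  have r := congrArg (eval x) (hillSol_add_two ha 0 1 N)
  have hN : a t N = a t 0 := by simpa using hp 0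
  have hN1 : a t (N + 1) = a t 1 := by rw [add_comm]; exact hp 1
  have hN2 : a t (N - 1) = a t (-1) := by rw [sub_eq_neg_add]; exact hp (-1)
  rw [hillSol_eq_theta_add_phi (a t) (_ + _) (_ - _) N,
    hillSol_eq_theta_add_phi (a t) (_ + _) (_ - _) (N + 1)]
  simp only [eval_mul, eval_sub, eval_add, eval_C, eval_X, hillTheta, hillPhi] at r ⊢
  push_cast
  rw [add_sub_cancel_right]
  rw [hN, hN1] at r
  rw [hN, hN1, hN2]
  linear_combination 4 * x * r

/-- At a zero of `θ_{N+1}`, the commutator of the Lax matrix with the monodromy matrix has only one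
term left in the entry `θ_{N+1}`. -/
theorem hasDerivAt_hillTheta_eval {a : ℝ → ℤ → ℝ} {t : ℝ} {N : ℕ} (ha : ∀ n, 0 < a t n)
    (hp : ∀ n, a t (n + N) = a t n)
    (hd : ∀ n, HasDerivAt (fun s => a s n) (2 * a t n * (a t (n + 1) ^ 2 - a t (n - 1) ^ 2)) t)
    {x : ℝ} (hx : (hillTheta (a t) 0 (N + 1)).eval x = 0) :
    HasDerivAt (fun s => (hillTheta (a s) 0 (N + 1)).eval x)
      (-4 * x * a t 0 * ((hillTheta (a t) 0 N).eval x - (hillPhi (a t) 0 (N + 1)).eval x)) t := by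
  refine (hasDerivAt_hillSol_eval ha hd 1 0 x (N + 1)).congr_deriv ?_
  have r := congrArg (eval x) (hillSol_add_two ha 1 0 N)
  have hN : a t N = a t 0 := by simpa using hp 0
  have hN1 : a t (N + 1) = a t 1 := by rw [add_comm]; exact hp 1
  rw [hillSol_eq_theta_add_phi (a t) (_ + _) (_ - _) (N + 1)]
  simp only [eval_mul, eval_sub, eval_add, eval_C, eval_X, hillTheta, hillPhi] at r hx ⊢
  push_cast
  rw [add_sub_cancel_right]
  rw [hN, hN1, hx] at r
  rw [hN, hN1, hx]
  linear_combination 4 * x * r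

theorem contDiffAt_hillSol_eval {a : ℝ → ℤ → ℝ} {t : ℝ} (ha : ∀ n, 0 < a t n)
    (hC : ∀ n, ContDiffAt ℝ 1 (fun s => a s n) t) (c d x : ℝ) :
    ∀ n : ℕ, ContDiffAt ℝ 1 (fun q : ℝ × ℝ => (hillSol (a q.1) 0 c d n).eval q.2) (t, x)
  | 0 => by simpa [hillSol] using contDiffAt_const
  | 1 => by simpa [hillSol] using contDiffAt_const
  | n + 2 => by
    have h₀ := contDiffAt_hillSol_eval ha hC c d x n
    have h₁ := contDiffAt_hillSol_eval ha hC c d x (n + 1)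
    have hc (m : ℤ) : ContDiffAt ℝ 1 (fun q : ℝ × ℝ => a q.1 m) (t, x) :=
      (hC m).comp (t, x) contDiffAt_fst
    simp only [hillSol, Pi.zero_apply, C_0, sub_zero, eval_mul, eval_sub, eval_C, eval_X]
    exact ((hc _).inv (ha _).ne').mul ((contDiffAt_snd.mul h₁).sub ((hc _).mul h₀))

/-- The motion of the auxiliary spectrum, before the square root of the band-edge product is
introduced. -/
theorem hasDerivAt_sortedRoot_hillTheta {a : ℝ → ℤ → ℝ} {I : Set ℝ} (hI : IsOpen I) {N : ℕ}
    (hN : 1 ≤ N) (ha : ∀ t ∈ I, ∀ n, 0 < a t n) (hp : ∀ t ∈ I, ∀ n, a t (n + N) = a t n)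
    (hd : ∀ t ∈ I, ∀ n,
      HasDerivAt (fun s => a s n) (2 * a t n * (a t (n + 1) ^ 2 - a t (n - 1) ^ 2)) t)
    {t : ℝ} (ht : t ∈ I) (j : Fin (N - 1)) {μ : Fin (N - 1) → ℝ}
    (hμ : μ = fun j : Fin (N - 1) => sortedRoot (hillTheta (a t) 0 (N + 1)) j) :
    HasDerivAt (fun s => sortedRoot (hillTheta (a s) 0 (N + 1)) j)
      (-4 * μ j * ((∏ i ∈ Finset.range N, a t (i + 1))
        * ((hillTheta (a t) 0 N).eval (μ j) - 1 / (hillTheta (a t) 0 N).eval (μ j))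
        / ∏ i ∈ Finset.univ.erase j, (μ j - μ i))) t := by
  have hroot (j : Fin (N - 1)) : (hillTheta (a t) 0 (N + 1)).eval (μ j) = 0 :=
    (hillTheta_eval_eq_zero_iff hN (ha t ht) (hp t ht) _).mpr ⟨j, by rw [hμ]⟩
  have hCD (n : ℤ) : ContDiffAt ℝ 1 (fun s => a s n) t := by
    have hcont (m : ℤ) : ContinuousOn (fun s => a s m) I :=
      fun s hs => (hd s hs m).continuousAt.continuousWithinAt
    have : ContDiffOn ℝ (0 + 1) (fun s => a s n) I := by
      refine (contDiffOn_succ_iff_deriv_of_isOpen hI).mpr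
        ⟨fun s hs => (hd s hs n).differentiableAt.differentiableWithinAt, by simp,
          contDiffOn_zero.mpr ?_⟩
      refine ContinuousOn.congr ?_ fun s hs => (hd s hs n).deriv
      exact ((continuousOn_const.mul (hcont n)).mul
        (((hcont (n + 1)).pow 2).sub ((hcont (n - 1)).pow 2)))
    rw [zero_add] at this
    exact this.contDiffAt (hI.mem_nhds ht)
  have hev := hI.mem_nhds ht
  have hmono := hillTheta_sortedRoot_strictMono hN (ha t ht) (hp t ht)
  have hA : (∏ i ∈ Finset.range N, a t (i + 1)) ≠ 0 :=
    Finset.prod_ne_zero_iff.mpr fun i _ => (ha t ht _).ne'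
  have h := hasDerivAt_sortedRoot (p := fun s => hillTheta (a s) 0 (N + 1)) (m := N - 1) (t := t)
    (Filter.mem_of_superset hev fun s hs => hillTheta_ne_zero hN (ha s hs))
    (Filter.mem_of_superset hev fun s hs => (hillTheta_natDegree hN (ha s hs)).le)
    hmono (fun j => by simpa only [hμ] using hroot j)
    (fun j => hillTheta_derivative_ne_zero_of_root hN (ha t ht) (hp t ht)
      (by simpa only [hμ] using hroot j))
    (fun j => contDiffAt_hillSol_eval (ha t ht) hCD 1 0 _ (N + 1)) j
    (hasDerivAt_hillTheta_eval (ha t ht) (hp t ht) (hd t ht) (by simpa only [hμ] using hroot j))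
  refine h.congr_deriv ?_
  rw [hillTheta_derivative_eval_sortedRoot hN (ha t ht) (hp t ht) j]
  have hphi := (hillDiscriminant_eval_of_root (ha t ht) (hp t ht) (hroot j)).1
  rw [hphi]
  subst hμ
  dsimp only
  have hP : ∏ i ∈ Finset.univ.erase j, (sortedRoot (hillTheta (a t) 0 (N + 1)) j
      - sortedRoot (hillTheta (a t) 0 (N + 1)) i) ≠ 0 :=
    Finset.prod_ne_zero_iff.mpr fun i hi =>
      sub_ne_zero.mpr (hmono.injective.ne (Finset.ne_of_mem_erase hi).symm)
  have h0 := (ha t ht 0).ne'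
  field_simp

/-! ### Periodic solutions of the Volterra chain -/

theorem volterraCoeff_pos {N : ℕ} {I : Set ℝ} {u : ℤ → ℝ → ℝ}
    (hu : IsPeriodicVolterraSolution N I u) {t : ℝ} (ht : t ∈ I) (n : ℤ) :
    0 < volterraCoeff u t n :=
  mul_pos (by norm_num) (Real.sqrt_pos.mpr (hu.pos n t ht))

theorem volterraCoeff_periodic {N : ℕ} {I : Set ℝ} {u : ℤ → ℝ → ℝ}
    (hu : IsPeriodicVolterraSolution N I u) {t : ℝ} (ht : t ∈ I) (n : ℤ) :
    volterraCoeff u t (n + N) = volterraCoeff u t n := by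
  rw [volterraCoeff, hu.periodic n t ht, volterraCoeff]

theorem hasDerivAt_volterraCoeff {N : ℕ} {I : Set ℝ} {u : ℤ → ℝ → ℝ}
    (hu : IsPeriodicVolterraSolution N I u) {t : ℝ} (ht : t ∈ I) (n : ℤ) :
    HasDerivAt (fun s => volterraCoeff u s n) (2 * volterraCoeff u t n
      * (volterraCoeff u t (n + 1) ^ 2 - volterraCoeff u t (n - 1) ^ 2)) t := by
  refine (((hu.deriv_eq n t ht).sqrt (hu.pos n t ht).ne').const_mul (1 / 2)).congr_deriv ?_
  have h := Real.sq_sqrt (hu.pos n t ht).le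
  have h0 := (Real.sqrt_pos.mpr (hu.pos n t ht)).ne'
  simp only [volterraCoeff, mul_pow, Real.sq_sqrt (hu.pos _ t ht).le]
  field_simp
  rw [h]
  ring

/-- The band edges do not depend on the site at which the period starts. -/
theorem bandEdge_eq_sortedRoot_shift {N : ℕ} {I : Set ℝ} {u : ℤ → ℝ → ℝ}
    (hu : IsPeriodicVolterraSolution N I u) {t : ℝ} (ht : t ∈ I) (k : ℤ) (i : Fin (2 * N)) :
    bandEdge N u i t = sortedRoot
      (hillDiscriminant (fun m => volterraCoeff u t (m + k)) 0 N ^ 2 - 4) i := by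
  rw [hillDiscriminant_shift_int (volterraCoeff_pos hu ht) (volterraCoeff_periodic hu ht) k,
    bandEdge]

theorem bandEdge_eq_of_mem {N : ℕ} {I : Set ℝ} (hI : IsOpen I) (hI' : I.OrdConnected)
    {u : ℤ → ℝ → ℝ} (hu : IsPeriodicVolterraSolution N I u) (i : Fin (2 * N)) {s t : ℝ}
    (hs : s ∈ I) (ht : t ∈ I) : bandEdge N u i s = bandEdge N u i t := by
  have hΔ : hillDiscriminant (volterraCoeff u s) 0 N = hillDiscriminant (volterraCoeff u t) 0 N := by
    refine funext fun x => ?_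
    have hd (r : ℝ) (hr : r ∈ I) := hasDerivAt_hillDiscriminant_eval (volterraCoeff_pos hu hr)
      (volterraCoeff_periodic hu hr) (hasDerivAt_volterraCoeff hu hr) x
    exact hI.is_const_of_deriv_eq_zero hI'.isPreconnected
      (fun r hr => (hd r hr).differentiableAt.differentiableWithinAt)
      (fun r hr => (hd r hr).deriv) hs ht
  rw [bandEdge, bandEdge, hΔ]

theorem auxParam_strictMono {N : ℕ} (hN : 1 ≤ N) {I : Set ℝ} {u : ℤ → ℝ → ℝ}
    (hu : IsPeriodicVolterraSolution N I u) (k : ℤ) {t : ℝ} (ht : t ∈ I) :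
    StrictMono fun j => auxParam N u k j t :=
  hillTheta_sortedRoot_strictMono hN (fun _ => volterraCoeff_pos hu ht _)
    fun n => by rw [add_right_comm]; exact volterraCoeff_periodic hu ht _

theorem volterraTheta_eval_eq_zero_iff {N : ℕ} (hN : 1 ≤ N) {I : Set ℝ} {u : ℤ → ℝ → ℝ}
    (hu : IsPeriodicVolterraSolution N I u) (k : ℤ) {t : ℝ} (ht : t ∈ I) (x : ℝ) :
    (volterraTheta u k t (N + 1)).eval x = 0 ↔ ∃ j, x = auxParam N u k j t :=
  hillTheta_eval_eq_zero_iff hN (fun _ => volterraCoeff_pos hu ht _)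
    (fun n => by rw [add_right_comm]; exact volterraCoeff_periodic hu ht _) x

theorem prod_auxParam_sub_bandEdge {N : ℕ} (hN : 1 ≤ N) {I : Set ℝ} {u : ℤ → ℝ → ℝ}
    (hu : IsPeriodicVolterraSolution N I u) (k : ℤ) {t : ℝ} (ht : t ∈ I) (j : Fin (N - 1)) :
    ∏ i : Fin (2 * N), (auxParam N u k j t - bandEdge N u i t)
      = ((∏ n ∈ Finset.range N, volterraCoeff u t (n + 1 + k))
        * ((volterraTheta u k t N).eval (auxParam N u k j t)
          - 1 / (volterraTheta u k t N).eval (auxParam N u k j t))) ^ 2 := by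
  simp only [bandEdge_eq_sortedRoot_shift hu ht k]
  exact prod_sub_bandEdge_of_root (a := fun m => volterraCoeff u t (m + k)) hN
    (fun _ => volterraCoeff_pos hu ht _)
    (fun n => by rw [add_right_comm]; exact volterraCoeff_periodic hu ht _)
    ((volterraTheta_eval_eq_zero_iff hN hu k ht _).mpr ⟨j, rfl⟩)

/-- The sign `σ` selects the branch of the square root of the band-edge product. -/
theorem auxSign_mul_auxRoot {N : ℕ} (hN : 1 ≤ N) {I : Set ℝ} {u : ℤ → ℝ → ℝ}
    (hu : IsPeriodicVolterraSolution N I u) (k : ℤ) {t : ℝ} (ht : t ∈ I) (j : Fin (N - 1)) :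
    auxSign N u k j t * auxRoot N u k j t
      = (∏ n ∈ Finset.range N, volterraCoeff u t (n + 1 + k))
        * ((volterraTheta u k t N).eval (auxParam N u k j t)
          - 1 / (volterraTheta u k t N).eval (auxParam N u k j t)) := by
  rw [auxSign, auxRoot, prod_auxParam_sub_bandEdge hN hu k ht j]
  exact sign_mul_sqrt_sq_mul (Finset.prod_nonneg fun n _ => (volterraCoeff_pos hu ht _).le)

theorem hasDerivAt_auxParam {N : ℕ} (hN : 1 ≤ N) {I : Set ℝ} (hI : IsOpen I) {u : ℤ → ℝ → ℝ}
    (hu : IsPeriodicVolterraSolution N I u) (k : ℤ) (j : Fin (N - 1)) {t : ℝ} (ht : t ∈ I) :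
    HasDerivAt (auxParam N u k j)
      (-4 * auxParam N u k j t * auxSign N u k j t * (auxRoot N u k j t
        / ∏ i ∈ Finset.univ.erase j, (auxParam N u k j t - auxParam N u k i t))) t := by
  have h := hasDerivAt_sortedRoot_hillTheta (a := fun s m => volterraCoeff u s (m + k)) hI hN
    (fun s hs n => volterraCoeff_pos hu hs _)
    (fun s hs n => by rw [add_right_comm]; exact volterraCoeff_periodic hu hs _)
    (fun s hs n => by
      rw [add_right_comm n 1 k, sub_add_eq_add_sub]
      exact hasDerivAt_volterraCoeff hu hs (n + k)) ht j rfl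
  refine h.congr_deriv ?_
  have hD := auxSign_mul_auxRoot hN hu k ht j
  rw [mul_assoc (-4 * _), ← mul_div_assoc (auxSign N u k j t), hD]
  rfl

theorem auxSign_mul_auxRoot_ne_zero {N : ℕ} (hN : 1 ≤ N) {I : Set ℝ} {u : ℤ → ℝ → ℝ}
    (hu : IsPeriodicVolterraSolution N I u) (k : ℤ) {t : ℝ} (ht : t ∈ I) (j : Fin (N - 1))
    (hne : ∀ i, auxParam N u k j t ≠ bandEdge N u i t) :
    auxSign N u k j t * auxRoot N u k j t ≠ 0 := by
  rw [auxSign_mul_auxRoot hN hu k ht j]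
  have h := prod_auxParam_sub_bandEdge hN hu k ht j
  have h0 : ∏ i : Fin (2 * N), (auxParam N u k j t - bandEdge N u i t) ≠ 0 :=
    Finset.prod_ne_zero_iff.mpr fun i _ => sub_ne_zero.mpr (hne i)
  rw [h] at h0
  exact fun h1 => h0 (by rw [h1]; simp)

/-- Dividing the equation of motion by `D_j` leaves a Lagrange sum over the auxiliary spectrum. -/
theorem sum_auxParam_pow_mul_deriv_div {N : ℕ} (hN : 1 ≤ N) {I : Set ℝ} (hI : IsOpen I)
    {u : ℤ → ℝ → ℝ} (hu : IsPeriodicVolterraSolution N I u) (k : ℤ) {t : ℝ} (ht : t ∈ I)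
    (hne : ∀ j i, auxParam N u k j t ≠ bandEdge N u i t) (s : ℕ) :
    ∑ j, auxParam N u k j t ^ s * deriv (auxParam N u k j) t
        / (auxSign N u k j t * auxRoot N u k j t)
      = -4 * ∑ j, auxParam N u k j t ^ (s + 1)
        / ∏ i ∈ Finset.univ.erase j, (auxParam N u k j t - auxParam N u k i t) := by
  rw [Finset.mul_sum]
  refine Finset.sum_congr rfl fun j _ => ?_
  rw [(hasDerivAt_auxParam hN hI hu k j ht).deriv]
  have h := auxSign_mul_auxRoot_ne_zero hN hu k ht j (hne j)
  rw [div_eq_iff h]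
  ring

theorem mainTheorem2 (N : ℕ) (hN : 1 ≤ N) (I : Set ℝ) (hI : IsOpen I) (hI' : I.OrdConnected)
    (u : ℤ → ℝ → ℝ) (hu : IsPeriodicVolterraSolution N I u) :
    -- the band edges are all the zeros of `Δ² - 4`, with multiplicity, and do not depend on time
    (∀ t ∈ I, hillDiscriminant (volterraCoeff u t) 0 N ^ 2 - 4
        = C ((∏ n ∈ Finset.range N, volterraCoeff u t (n + 1))⁻¹ ^ 2)
          * ∏ i : Fin (2 * N), (X - C (bandEdge N u i t))) ∧
    (∀ i, ∀ s ∈ I, ∀ t ∈ I, bandEdge N u i s = bandEdge N u i t) ∧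
    -- the `μ_{j,k}` are `N - 1` distinct numbers, namely all the zeros of `θ_{N+1,k}`,
    -- and the reciprocals and the square roots below are genuine
    (∀ k : ℤ, ∀ t ∈ I, StrictMono (fun j => auxParam N u k j t) ∧
      (∀ x : ℝ, (volterraTheta u k t (N + 1)).eval x = 0 ↔ ∃ j, x = auxParam N u k j t) ∧
      (∀ j, (volterraTheta u k t N).eval (auxParam N u k j t) ≠ 0) ∧
      (∀ j, 0 ≤ ∏ i : Fin (2 * N), (auxParam N u k j t - bandEdge N u i t))) ∧
    -- the evolution of `μ_j = μ_{j,0}`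
    (∀ j, ∀ t ∈ I, HasDerivAt (auxParam N u 0 j)
      (-4 * auxParam N u 0 j t * auxSign N u 0 j t * (auxRoot N u 0 j t
        / ∏ i ∈ Finset.univ.erase j, (auxParam N u 0 j t - auxParam N u 0 i t))) t) ∧
    -- the evolution of the shifted parameters `μ_{j,k}`
    (∀ k : ℤ, ∀ j, ∀ t ∈ I, HasDerivAt (auxParam N u k j)
      (-4 * auxParam N u k j t * auxSign N u k j t * (auxRoot N u k j t
        / ∏ i ∈ Finset.univ.erase j, (auxParam N u k j t - auxParam N u k i t))) t) ∧
    -- the Abel-type identities, at the times at which no denominator vanishes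
    (4 ≤ N → ∀ t ∈ I, (∀ j i, auxParam N u 0 j t ≠ bandEdge N u i t) →
      (∀ j, auxSign N u 0 j t * auxRoot N u 0 j t ≠ 0) ∧
      (∀ s ∈ Finset.Icc 1 (N - 3),
        ∑ j, auxParam N u 0 j t ^ (s - 1) * deriv (auxParam N u 0 j) t
          / (auxSign N u 0 j t * auxRoot N u 0 j t) = 0) ∧
      ∑ j, auxParam N u 0 j t ^ (N - 3) * deriv (auxParam N u 0 j) t
          / (auxSign N u 0 j t * auxRoot N u 0 j t) = -4 ∧
      ∑ j, auxParam N u 0 j t ^ (N - 2) * deriv (auxParam N u 0 j) t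
          / (auxSign N u 0 j t * auxRoot N u 0 j t) = 0) := by
  refine ⟨fun t ht => hillDiscriminant_sq_sub_four_eq hN (volterraCoeff_pos hu ht)
      (volterraCoeff_periodic hu ht),
    fun i s hs t ht => bandEdge_eq_of_mem hI hI' hu i hs ht,
    fun k t ht => ⟨auxParam_strictMono hN hu k ht, volterraTheta_eval_eq_zero_iff hN hu k ht,
      fun j => ?_, fun j => ?_⟩,
    fun j t ht => hasDerivAt_auxParam hN hI hu 0 j ht,
    fun k j t ht => hasDerivAt_auxParam hN hI hu k j ht,
    fun hN4 t ht hne => ⟨fun j => auxSign_mul_auxRoot_ne_zero hN hu 0 ht j (hne j), ?_, ?_, ?_⟩⟩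
  · exact hillTheta_eval_ne_zero_of_root (fun _ => volterraCoeff_pos hu ht _)
      (fun n => by rw [add_right_comm]; exact volterraCoeff_periodic hu ht _)
      ((volterraTheta_eval_eq_zero_iff hN hu k ht _).mpr ⟨j, rfl⟩)
  · rw [prod_auxParam_sub_bandEdge hN hu k ht j]
    exact sq_nonneg _
  · intro s hs
    rw [Finset.mem_Icc] at hs
    rw [sum_auxParam_pow_mul_deriv_div hN hI hu 0 ht hne, Nat.sub_add_cancel hs.1,
      sum_pow_div_prod_sub (auxParam_strictMono hN hu 0 ht).injective (by omega),
      if_neg (by omega), mul_zero]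
  · rw [sum_auxParam_pow_mul_deriv_div hN hI hu 0 ht hne,
      sum_pow_div_prod_sub (auxParam_strictMono hN hu 0 ht).injective (by omega),
      if_pos (by omega), mul_one]
  · -- the exponent `N - 1` is the number of nodes, and the nodes sum to zero by parity
    rw [sum_auxParam_pow_mul_deriv_div hN hI hu 0 ht hne, show N - 2 + 1 = N - 1 by omega,
      sum_pow_card_div_prod_sub (by omega) (auxParam_strictMono hN hu 0 ht).injective
        (sum_sortedRoot_hillTheta hN (fun _ => volterraCoeff_pos hu ht _)
          fun n => by rw [add_right_comm]; exact volterraCoeff_periodic hu ht _), mul_zero]
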